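/- Let $P\subseteq\mathbb{R}^n$ be an extended generalized permutohedron, i.e. a nonempty polyhedron (possibly unbounded) whose normal fan is a coarsening of a subfan of the fan of the braid arrangement $\{x_i=x_j\}_{1\le i<j\le n}$ in $\mathbb{R}^n$; this includes every $(n-1)$-dimensional one. Let $L(P)$ be the set of nonempty faces of $P$. For $G\in L(P)$ let $C_G=\{\omega\in\mathbb{R}^n : \langle\omega,y\rangle\le\langle\omega,x\rangle \text{ for all } x\in G,\ y\in P\}$ be its normal cone and $C_G^\circ$ the relative interior of $C_G$. Let $$F_q(P)=\sum_{G\in L(P)}q^{\dim G}\sum_{\omega\in\mathbb{Z}_{>0}^n\cap C_G^\circ}x_{\omega_1}x_{\omega_2}\cdots x_{\omega_n},$$ a formal power series in $x_1,x_2,x_3,\dots$ with coefficients in $\mathbb{Q}[q]$, and let $F_{-q}(P)$ be obtained from it by replacing $q$ by $-q$. Then $F_{-q}(P)$ is a homogeneous quasisymmetric function of degree $n$, that is, a linear combination over $\mathbb{Q}[q]$ of the monomial quasisymmetric functions $M_\alpha=\sum_{i_1<\cdots<i_k}x_{i_1}^{\alpha_1}\cdots x_{i_k}^{\alpha_k}$,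 where $\alpha=(\alpha_1,\dots,\alpha_k)$ runs over the compositions of $n$. Its principal specialization $$\mathbf{ps}^1(F_{-q}(P))(m)=F_{-q}(P)(\underbrace{1,\dots,1}_{m},0,0,\dots),\qquad m\in\mathbb{N},$$ is a polynomial in $m$ and so can be evaluated at $m=-1$. If $f(P,q)=\sum_i f_i q^i$ is the $f$-polynomial of $P$, where $f_i$ is the number of $i$-dimensional faces of $P$, then $$f(P,q)=(-1)^{n}\,\mathbf{ps}^1(F_{-q}(P))(-1).$$ -/

import Mathlib

open scoped Polynomial

noncomputable section

namespace ExtPerm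

/-! ### Polyhedra, faces, normal fans -/

/-- A convex polyhedron in `ℝⁿ`: the solution set of finitely many weak linear inequalities. -/
def IsPolyhedron {n : ℕ} (P : Set (Fin n → ℝ)) : Prop :=
  ∃ (k : ℕ) (a : Fin k → Fin n → ℝ) (b : Fin k → ℝ), P = {x | ∀ i, a i ⬝ᵥ x ≤ b i}

/-- The nonempty faces of `P`: the nonempty sets of points at which some linear functional attains
its maximum over `P` (the zero functional gives `P` itself). -/
def faces {n : ℕ} (P : Set (Fin n → ℝ)) : Set (Set (Fin n → ℝ)) :=
  {G | G.Nonempty ∧ IsExposed ℝ P G}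

/-- The dimension of a nonempty set: the dimension of its affine hull. -/
def dim {n : ℕ} (G : Set (Fin n → ℝ)) : ℕ :=
  Module.finrank ℝ (vectorSpan ℝ G)

/-- The (closed) normal cone of `P` at its face `G`: all weights `ω` such that `⟨ω, ·⟩` attains
its maximum over `P` at every point of `G`. -/
def normalCone {n : ℕ} (P G : Set (Fin n → ℝ)) : Set (Fin n → ℝ) :=
  {ω | ∀ x ∈ G, ∀ y ∈ P, ω ⬝ᵥ y ≤ ω ⬝ᵥ x}

/-- The normal fan of `P`, as a set of cones. -/
def normalFan {n : ℕ} (P : Set (Fin n → ℝ)) : Set (Set (Fin n → ℝ)) :=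
  {C | ∃ G ∈ faces P, C = normalCone P G}

/-! ### The braid arrangement fan -/

/-- A flag `∅ = F₀ ⊂ F₁ ⊂ ⋯ ⊂ F_k = [n]` of subsets of `[n]`. -/
structure Flag (n : ℕ) where
  toSeries : LTSeries (Finset (Fin n))
  head_eq : toSeries.head = ∅
  last_eq : toSeries.last = Finset.univ

/-- The block `F_{i+1} \ F_i` of a flag. -/
def Flag.block {n : ℕ} (F : Flag n) (i : Fin F.toSeries.length) : Finset (Fin n) :=
  F.toSeries i.succ \ F.toSeries i.castSucc

/-- The closed braid cone of a flag: coordinates are constant on each block and weakly increase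
from each block to the later ones. -/
def Flag.braidCone {n : ℕ} (F : Flag n) : Set (Fin n → ℝ) :=
  {x | (∀ i, ∀ p ∈ F.block i, ∀ q ∈ F.block i, x p = x q) ∧
    ∀ i j, i < j → ∀ p ∈ F.block i, ∀ q ∈ F.block j, x p ≤ x q}

/-- The fan of the braid arrangement `{x_i = x_j}` in `ℝⁿ`. -/
def braidFan (n : ℕ) : Set (Set (Fin n → ℝ)) :=
  Set.range (Flag.braidCone (n := n))

/-- A subfan of the braid fan: a set of braid cones closed under passing to faces. -/
def IsBraidSubfan {n : ℕ} (S : Set (Set (Fin n → ℝ))) : Prop :=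
  S ⊆ braidFan n ∧ ∀ C ∈ S, faces C ⊆ S

/-- `N` is a coarsening of `S`: every cone of `S` lies in a cone of `N`, and every cone of `N` is a
union of cones of `S`. -/
def IsCoarsening {n : ℕ} (N S : Set (Set (Fin n → ℝ))) : Prop :=
  (∀ C ∈ S, ∃ D ∈ N, C ⊆ D) ∧ ∀ D ∈ N, ∃ T ⊆ S, D = ⋃₀ T

/-- Extended generalized permutohedra in `ℝⁿ`: nonempty polyhedra (possibly unbounded) whose normal
fan is a coarsening of a subfan of the braid arrangement fan. -/
def IsExtendedGeneralizedPermutohedron {n : ℕ} (P : Set (Fin n → ℝ)) : Prop :=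
  IsPolyhedron P ∧ P.Nonempty ∧ ∃ S, IsBraidSubfan S ∧ IsCoarsening (normalFan P) S

/-- The `f`-polynomial `f₀ + f₁ q + f₂ q² + ⋯`, where `f_i` is the number of `i`-dimensional
faces of `P`. -/
def fPolynomial {n : ℕ} (P : Set (Fin n → ℝ)) : ℚ[X] :=
  ∑ i ∈ Finset.range (dim P + 1),
    Polynomial.C (({G ∈ faces P | dim G = i}.ncard : ℕ) : ℚ) * Polynomial.X ^ i

/-! ### Quasisymmetric functions, in the variables `x₁, x₂, x₃, …` -/

open Classical in
/-- The monomial quasisymmetric function `M_α = ∑_{i₁ < ⋯ < i_k} x_{i₁}^{α₁} ⋯ x_{i_k}^{α_k}`. -/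
def monomialQSym (R : Type*) [CommRing R] {n : ℕ} (α : Composition n) : MvPowerSeries ℕ+ R :=
  fun d => if ∃ i : Fin α.length → ℕ+, StrictMono i ∧
    d = ∑ j, Finsupp.single (i j) (α.blocksFun j) then 1 else 0

/-- The degree `n` homogeneous component of the algebra of quasisymmetric functions. -/
def QSym (R : Type*) [CommRing R] (n : ℕ) : Submodule R (MvPowerSeries ℕ+ R) :=
  Submodule.span R (Set.range (monomialQSym R (n := n)))

/-- `F(1, …, 1, 0, 0, …)` with `m` ones: the sum of the coefficients of all monomials in
`x₁, …, x_m` (only finitely many of them are nonzero for a quasisymmetric function). -/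
def specialize {R : Type*} [CommRing R] (F : MvPowerSeries ℕ+ R) (m : ℕ) : R :=
  ∑ᶠ (d : ℕ+ →₀ ℕ) (_ : ∀ i ∈ d.support, (i : ℕ) ≤ m), MvPowerSeries.coeff d F

open Classical in
/-- The principal specialization `ps¹(F)` as a polynomial in `m`: the polynomial whose value at
every `m ∈ ℕ` is `F(1, …, 1, 0, 0, …)` with `m` ones (and `0` if there is no such polynomial). -/
def ps1 {R : Type*} [CommRing R] (F : MvPowerSeries ℕ+ R) : R[X] :=
  if h : ∃ p : R[X], ∀ m : ℕ, p.eval (m : R) = specialize F m then h.choose else 0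

/-! ### The weighted enumerator -/

/-- `∑_ω x_{ω₁} ⋯ x_{ω_n}`, over the positive integer vectors `ω` lying in `C`: the coefficient of
a monomial is the (finite) number of `ω` which give that monomial. -/
def latticeEnumerator (R : Type*) [CommRing R] {n : ℕ} (C : Set (Fin n → ℝ)) :
    MvPowerSeries ℕ+ R :=
  fun d => (({ω : Fin n → ℕ+ | (fun i => ((ω i : ℕ) : ℝ)) ∈ C ∧
    ∑ i, Finsupp.single (ω i) 1 = d}.ncard : ℕ) : R)

/-- `F_t(G) = t^{dim G} ∑_ω x_{ω₁} ⋯ x_{ω_n}`, over the positive integer vectors `ω` in the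
relative interior of the normal cone of `P` at its face `G`. -/
def faceEnumerator {R : Type*} [CommRing R] {n : ℕ} (t : R) (P G : Set (Fin n → ℝ)) :
    MvPowerSeries ℕ+ R :=
  t ^ dim G • latticeEnumerator R (intrinsicInterior ℝ (normalCone P G))

/-- `F_t(P)`, the sum of `F_t(G)` over all (finitely many) faces `G` of the polyhedron `P`. -/
def enumerator {R : Type*} [CommRing R] {n : ℕ} (t : R) (P : Set (Fin n → ℝ)) :
    MvPowerSeries ℕ+ R :=
  ∑ᶠ G ∈ faces P, faceEnumerator t P G

end ExtPerm

end

/-! Evaluating `ps¹` at `-1` computes an Euler characteristic with compact support. The vectors with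
a fixed weak order of coordinates, with `k` distinct values, form a relatively open cone of
dimension `k`. Its positive lattice points enumerate a monomial function `M_α` with `k` parts, whose
specialization is `m.choose k`. At `m = -1` this gives `(-1) ^ k`, the Euler characteristic of the
cone (`HasSpecialization.monomialQSym`, `eulerChar_orderCell`).

Both sides are additive over the cells of the braid arrangement (`sum_eulerChar_cells`). The
coarsening hypothesis makes the relative interior of a normal cone a union of such cells, so its
enumerator specializes at `-1` to `(-1) ^ dim C_G` (`hasSpecialization_latticeEnumerator`).

Finally `dim G + dim C_G = n` (`IsPolyhedron.dim_add_dim_normalCone`), so the face `G` contributes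
`(-q) ^ dim G * (-1) ^ (n - dim G) = (-1) ^ n * q ^ dim G`. Summing over faces gives `(-1) ^ n`
times the `f`-polynomial. -/

namespace ExtPerm

open Filter Topology

/-! ### Relatively open convex sets and their Euler characteristic -/

section RelOpen

variable {E : Type*} [AddCommGroup E] [Module ℝ E]

/-- Every segment inside `A` can be prolonged a little beyond its endpoints. -/
def RelOpen (A : Set E) : Prop :=
  ∀ x ∈ A, ∀ z ∈ A, ∀ᶠ ε : ℝ in 𝓝 0, x + ε • (z - x) ∈ A

theorem mem_vectorSpan_of_eventually {B : Set E} {x v : E} (hx : x ∈ B)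
    (h : ∀ᶠ ε : ℝ in 𝓝 0, x + ε • v ∈ B) : v ∈ vectorSpan ℝ B := by
  have h' : ∀ᶠ ε : ℝ in 𝓝[≠] 0, x + ε • v ∈ B := h.filter_mono nhdsWithin_le_nhds
  obtain ⟨ε, hε, hne⟩ := (h'.and self_mem_nhdsWithin).exists
  have h1 : (x + ε • v) -ᵥ x ∈ vectorSpan ℝ B := vsub_mem_vectorSpan ℝ hε hx
  rw [vsub_eq_sub, add_sub_cancel_left] at h1
  simpa [smul_smul, inv_mul_cancel₀ hne] using Submodule.smul_mem _ ε⁻¹ h1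

/-- Admissible directions at `x` are closed under sums because `x + ε • (v + w)` is the midpoint of
`x + 2ε • v` and `x + 2ε • w`. -/
theorem RelOpen.eventually_add_smul_mem {A : Set E} (hA : RelOpen A) (hc : Convex ℝ A) {x v : E}
    (hx : x ∈ A) (hv : v ∈ vectorSpan ℝ A) : ∀ᶠ ε : ℝ in 𝓝 0, x + ε • v ∈ A := by
  rw [vectorSpan_eq_span_vsub_set_right ℝ hx] at hv
  induction hv using Submodule.span_induction with
  | mem v hv =>
    obtain ⟨z, hz, rfl⟩ := hv
    exact hA x hx z hz
  | zero => simp [hx]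
  | add v w _ _ hv hw =>
    have ht : Tendsto (fun ε : ℝ => 2 * ε) (𝓝 0) (𝓝 0) := by
      simpa using (continuous_const_mul (2 : ℝ)).tendsto 0
    filter_upwards [ht.eventually hv, ht.eventually hw] with ε h1 h2
    have := hc h1 h2 (by norm_num : (0 : ℝ) ≤ 1 / 2) (by norm_num : (0 : ℝ) ≤ 1 / 2) (by norm_num)
    convert this using 1
    module
  | smul c v _ hv =>
    have ht : Tendsto (fun ε : ℝ => ε * c) (𝓝 0) (𝓝 0) := by
      simpa using (continuous_mul_const c).tendsto 0
    filter_upwards [ht.eventually hv] with ε h1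
    simpa [smul_smul] using h1

/-- The points where the functional `h` has sign `s`. -/
def signSet (h : E →ₗ[ℝ] ℝ) (s : SignType) : Set E := {x | SignType.sign (h x) = s}

theorem convex_signSet (h : E →ₗ[ℝ] ℝ) (s : SignType) : Convex ℝ (signSet h s) := by
  have : signSet h s = h ⁻¹' {t | SignType.sign t = s} := rfl
  rw [this]
  apply Convex.linear_preimage
  apply Set.OrdConnected.convex
  refine ⟨fun x hx y hy z hz => ?_⟩
  have h1 := SignType.sign.monotone hz.1
  have h2 := SignType.sign.monotone hz.2
  simp only [Set.mem_ofPred_eq] at hx hy ⊢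
  exact le_antisymm (h2.trans hy.le) (hx.ge.trans h1)

theorem eventually_sign_add_mul {a b : ℝ} (h : a = 0 → b = 0) :
    ∀ᶠ ε : ℝ in 𝓝 0, SignType.sign (a + ε * b) = SignType.sign a := by
  have ht : Tendsto (fun ε : ℝ => a + ε * b) (𝓝 0) (𝓝 a) := by
    have : Continuous fun ε : ℝ => a + ε * b := by fun_prop
    simpa using this.tendsto 0
  rcases lt_trichotomy a 0 with ha | ha | ha
  · filter_upwards [ht.eventually (gt_mem_nhds ha)] with ε hε
    rw [sign_neg ha, sign_neg hε]
  · simp [ha, h ha]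
  · filter_upwards [ht.eventually (lt_mem_nhds ha)] with ε hε
    rw [sign_pos ha, sign_pos hε]

theorem RelOpen.inter_signSet {A : Set E} (hA : RelOpen A) (h : E →ₗ[ℝ] ℝ) (s : SignType) :
    RelOpen (A ∩ signSet h s) := by
  rintro x ⟨hx, hxs⟩ z ⟨hz, hzs⟩
  have h0 : h x = 0 → h (z - x) = 0 := fun h0 => by
    rw [signSet, Set.mem_ofPred_eq] at hxs hzs
    rw [h0, sign_zero] at hxs
    rw [← hxs, sign_eq_zero_iff] at hzs
    simp [h0, hzs]
  filter_upwards [hA x hx z hz, eventually_sign_add_mul h0] with ε h1 h2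
  refine ⟨h1, ?_⟩
  rw [signSet, Set.mem_ofPred_eq] at hxs ⊢
  rw [map_add, map_smul, smul_eq_mul, h2, hxs]

open Classical in
/-- The Euler characteristic with compact support of a relatively open convex set. -/
noncomputable def eulerChar (R : Type*) [CommRing R] (A : Set E) : R :=
  if A.Nonempty then (-1) ^ Module.finrank ℝ (vectorSpan ℝ A) else 0

theorem eulerChar_eq (R : Type*) [CommRing R] {A : Set E} {x : E} (hx : x ∈ A)
    {W : Submodule ℝ E} (hW : vectorSpan ℝ A = W) :
    eulerChar R A = (-1) ^ Module.finrank ℝ W := by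
  subst hW
  exact if_pos ⟨x, hx⟩

/-- A nonzero sign persists under small moves, so an open half-space that meets `A` cuts out a piece
of full dimension. -/
theorem vectorSpan_inter_signSet {A : Set E} (hA : RelOpen A) (hc : Convex ℝ A)
    {h : E →ₗ[ℝ] ℝ} {x : E} (hx : x ∈ A) (h0 : h x ≠ 0) :
    vectorSpan ℝ (A ∩ signSet h (SignType.sign (h x))) = vectorSpan ℝ A := by
  refine le_antisymm (vectorSpan_mono _ Set.inter_subset_left) fun v hv => ?_
  refine mem_vectorSpan_of_eventually (x := x) ⟨hx, rfl⟩ ?_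
  filter_upwards [hA.eventually_add_smul_mem hc hx hv,
    eventually_sign_add_mul (b := h v) fun h1 => absurd h1 h0] with ε h1 h2
  refine ⟨h1, ?_⟩
  rw [signSet, Set.mem_ofPred_eq, map_add, map_smul, smul_eq_mul, h2]

theorem vectorSpan_inter_signSet_zero {A : Set E} (hA : RelOpen A) (hc : Convex ℝ A)
    {h : E →ₗ[ℝ] ℝ} {x : E} (hx : x ∈ A) (h0 : h x = 0) :
    vectorSpan ℝ (A ∩ signSet h 0) = vectorSpan ℝ A ⊓ LinearMap.ker h := by
  have hx' : x ∈ A ∩ signSet h 0 := ⟨hx, by simp [signSet, h0]⟩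
  refine le_antisymm (le_inf (vectorSpan_mono _ Set.inter_subset_left) ?_) fun v hv => ?_
  · rw [vectorSpan_eq_span_vsub_set_right ℝ hx', Submodule.span_le]
    rintro _ ⟨z, ⟨_, hz⟩, rfl⟩
    rw [signSet, Set.mem_ofPred_eq, sign_eq_zero_iff] at hz
    simp [h0, hz]
  · have hv0 : h v = 0 := hv.2
    refine mem_vectorSpan_of_eventually hx' ?_
    filter_upwards [hA.eventually_add_smul_mem hc hx hv.1] with ε h1
    exact ⟨h1, by simp [signSet, h0, hv0]⟩

theorem finrank_inf_ker [FiniteDimensional ℝ E] (W : Submodule ℝ E) {h : E →ₗ[ℝ] ℝ} {w : E}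
    (hw : w ∈ W) (h0 : h w ≠ 0) :
    Module.finrank ℝ (W ⊓ LinearMap.ker h : Submodule ℝ E) + 1 = Module.finrank ℝ W := by
  have hne : h.domRestrict W ≠ 0 := fun he => h0 (by
    simpa using LinearMap.congr_fun he ⟨w, hw⟩)
  rw [← Module.Dual.finrank_ker_add_one_of_ne_zero hne, ← Submodule.map_comap_subtype,
    Submodule.finrank_map_subtype_eq]
  rfl

theorem inter_signSet_eq_self {A : Set E} {h : E →ₗ[ℝ] ℝ} {s : SignType}
    (hs : ∀ x ∈ A, SignType.sign (h x) = s) : A ∩ signSet h s = A :=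
  Set.inter_eq_left.2 hs

theorem inter_signSet_eq_empty {A : Set E} {h : E →ₗ[ℝ] ℝ} {s t : SignType}
    (hs : ∀ x ∈ A, SignType.sign (h x) = s) (hst : s ≠ t) : A ∩ signSet h t = ∅ :=
  Set.eq_empty_of_forall_notMem fun x hx => hst ((hs x hx.1).symm.trans hx.2)

theorem sum_eulerChar_of_sign_const (R : Type*) [CommRing R] {A : Set E} {h : E →ₗ[ℝ] ℝ}
    {s : SignType} (hs : ∀ x ∈ A, SignType.sign (h x) = s) :
    ∑ t, eulerChar R (A ∩ signSet h t) = eulerChar R A := by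
  rw [Finset.sum_eq_single s, inter_signSet_eq_self hs]
  · intro t _ ht
    rw [inter_signSet_eq_empty hs ht.symm]
    simp [eulerChar]
  · simp

/-- A hyperplane that properly crosses `A` leaves pieces of dimensions `d`, `d` and `d - 1`, and `2
* (-1) ^ d + (-1) ^ (d - 1) = (-1) ^ d`. Otherwise `h` has constant sign on `A` and only one piece
is nonempty. -/
theorem sum_eulerChar_signSet (R : Type*) [CommRing R] [FiniteDimensional ℝ E] {A : Set E}
    (hA : RelOpen A) (hc : Convex ℝ A) (h : E →ₗ[ℝ] ℝ) :
    ∑ s, eulerChar R (A ∩ signSet h s) = eulerChar R A := by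
  by_cases hz : ∃ x ∈ A, h x = 0
  · obtain ⟨x, hx, hx0⟩ := hz
    by_cases hz' : ∃ z ∈ A, h z ≠ 0
    · obtain ⟨z, hz, hz0⟩ := hz'
      have hval : ∀ ε : ℝ, h (x + ε • (z - x)) = ε * h z := fun ε => by simp [hx0]
      have hev := hA x hx z hz
      obtain ⟨a, haA, ha⟩ : ∃ a ∈ A, 0 < h a := by
        rcases lt_or_gt_of_ne hz0 with hn | hp
        -- A negative `ε` prolongs the segment from `z` past the zero `x` of `h`, to the other side
        -- of the hyperplane.
        · obtain ⟨ε, hε, hlt⟩ := ((hev.filter_mono nhdsWithin_le_nhds).and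
            (self_mem_nhdsWithin : Set.Iio (0 : ℝ) ∈ 𝓝[<] 0)).exists
          exact ⟨_, hε, by rw [hval]; exact mul_pos_of_neg_of_neg hlt hn⟩
        · exact ⟨z, hz, hp⟩
      obtain ⟨b, hbA, hb⟩ : ∃ b ∈ A, h b < 0 := by
        rcases lt_or_gt_of_ne hz0 with hn | hp
        · exact ⟨z, hz, hn⟩
        · obtain ⟨ε, hε, hlt⟩ := ((hev.filter_mono nhdsWithin_le_nhds).and
            (self_mem_nhdsWithin : Set.Iio (0 : ℝ) ∈ 𝓝[<] 0)).exists
          exact ⟨_, hε, by rw [hval]; exact mul_neg_of_neg_of_pos hlt hp⟩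
      have h1 := vectorSpan_inter_signSet hA hc haA ha.ne'
      have h2 := vectorSpan_inter_signSet hA hc hbA hb.ne
      rw [sign_pos ha] at h1
      rw [sign_neg hb] at h2
      have h3 := vectorSpan_inter_signSet_zero hA hc hx hx0
      have h4 := finrank_inf_ker (vectorSpan ℝ A) (h := h)
        (vsub_mem_vectorSpan ℝ hz hx) (by simpa [hx0] using hz0)
      have e3 : x ∈ A ∩ signSet h 0 := ⟨hx, by simp [signSet, hx0]⟩
      have hsum : ∀ f : SignType → R, ∑ s, f s = f 0 + f (-1) + f 1 := fun f => by
        rw [show (Finset.univ : Finset SignType) = {0, -1, 1} from rfl]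
        rw [Finset.sum_insert (by decide), Finset.sum_insert (by decide), Finset.sum_singleton]
        ring
      have e1 : a ∈ A ∩ signSet h 1 := ⟨haA, sign_pos ha⟩
      have e2 : b ∈ A ∩ signSet h (-1) := ⟨hbA, sign_neg hb⟩
      rw [hsum, eulerChar_eq R e3 h3, eulerChar_eq R e2 h2, eulerChar_eq R e1 h1,
        eulerChar_eq R hx rfl, ← h4, pow_succ]
      ring
    · push Not at hz'
      exact sum_eulerChar_of_sign_const R (s := 0) fun y hy => by simp [hz' y hy]
  · push Not at hz
    rcases A.eq_empty_or_nonempty with rfl | ⟨x, hx⟩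
    · simp [eulerChar]
    · refine sum_eulerChar_of_sign_const R (s := SignType.sign (h x)) fun y hy => ?_
      by_contra hne
      have hpre : IsPreconnected (h '' A) :=
        (hc.linear_image h).isPreconnected
      have hord := hpre.ordConnected
      have hmem : (0 : ℝ) ∈ h '' A := by
        rcases lt_or_gt_of_ne (hz x hx) with h1 | h1 <;>
          rcases lt_or_gt_of_ne (hz y hy) with h2 | h2
        · exact absurd ((sign_neg h2).trans (sign_neg h1).symm) hne
        · exact hord.out ⟨x, hx, rfl⟩ ⟨y, hy, rfl⟩ ⟨h1.le, h2.le⟩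
        · exact hord.out ⟨y, hy, rfl⟩ ⟨x, hx, rfl⟩ ⟨h2.le, h1.le⟩
        · exact absurd ((sign_pos h2).trans (sign_pos h1).symm) hne
      obtain ⟨w, hw, hw0⟩ := hmem
      exact hz w hw hw0

theorem sum_eulerChar_cells_fin (R : Type*) [CommRing R] [FiniteDimensional ℝ E] {k : ℕ}
    (h : Fin k → E →ₗ[ℝ] ℝ) {A : Set E} (hA : RelOpen A) (hc : Convex ℝ A) :
    ∑ s : Fin k → SignType, eulerChar R (A ∩ {x | ∀ i, SignType.sign (h i x) = s i}) =
      eulerChar R A := by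
  induction k generalizing A with
  | zero => simp
  | succ k ih =>
    rw [← sum_eulerChar_signSet R hA hc (h 0), ← (Fin.consEquiv fun _ => SignType).sum_comp,
      Fintype.sum_prod_type]
    refine Finset.sum_congr rfl fun s _ => ?_
    rw [← ih (fun i => h i.succ) (hA.inter_signSet (h 0) s) (hc.inter (convex_signSet _ _))]
    refine Finset.sum_congr rfl fun t _ => ?_
    congr 1
    ext x
    simp [Fin.forall_fin_succ, Fin.consEquiv, signSet, and_assoc]

/-- The cells into which finitely many hyperplanes cut a relatively open convex set have
alternating count `(-1) ^ dim`. -/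
theorem sum_eulerChar_cells (R : Type*) [CommRing R] [FiniteDimensional ℝ E] {ι : Type*}
    [Fintype ι] [DecidableEq ι] (h : ι → E →ₗ[ℝ] ℝ) {A : Set E} (hA : RelOpen A)
    (hc : Convex ℝ A) :
    ∑ s : ι → SignType, eulerChar R (A ∩ {x | ∀ i, SignType.sign (h i x) = s i}) =
      eulerChar R A := by
  rw [← sum_eulerChar_cells_fin R (fun i => h ((Fintype.equivFin ι).symm i)) hA hc]
  refine Fintype.sum_equiv ((Fintype.equivFin ι).arrowCongr (Equiv.refl _)) _ _ fun s => ?_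
  congr 2
  ext x
  simp [(Fintype.equivFin ι).forall_congr_left]

end RelOpen

/-! ### Relative interiors -/

section Interior

variable {E : Type*} [NormedAddCommGroup E] [NormedSpace ℝ E]

/-- For the converse, take `z` in the relative interior and prolong the segment from `z` through `x`
to a point `w` of `D`. A homothety centred at `w` carries a neighbourhood of `x` in the affine span
into `D`, and convexity pulls that neighbourhood back into `D`. -/
theorem mem_intrinsicInterior_iff_eventually [FiniteDimensional ℝ E] {D : Set E}
    (hD : Convex ℝ D) {x : E} :
    x ∈ intrinsicInterior ℝ D ↔ x ∈ D ∧ ∀ z ∈ D, ∀ᶠ ε : ℝ in 𝓝 0, x + ε • (z - x) ∈ D := by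
  have hiff : ∀ {y : E}, y ∈ intrinsicInterior ℝ D ↔
      y ∈ D ∧ D ∈ 𝓝[(affineSpan ℝ D : Set E)] y := by
    intro y
    rw [mem_intrinsicInterior]
    constructor
    · rintro ⟨y, hy, rfl⟩
      refine ⟨interior_subset (s := ((↑) ⁻¹' D : Set (affineSpan ℝ D))) hy, ?_⟩
      exact preimage_coe_mem_nhds_subtype.1 (mem_interior_iff_mem_nhds.1 hy)
    · rintro ⟨hy, hn⟩
      refine ⟨⟨y, subset_affineSpan ℝ D hy⟩, ?_, rfl⟩
      rw [mem_interior_iff_mem_nhds]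
      exact preimage_coe_mem_nhds_subtype.2 hn
  constructor
  · intro hx
    obtain ⟨hxD, hn⟩ := hiff.1 hx
    refine ⟨hxD, fun z hz => ?_⟩
    have ht : Tendsto (fun ε : ℝ => x + ε • (z - x)) (𝓝 0)
        (𝓝[(affineSpan ℝ D : Set E)] x) := by
      refine tendsto_nhdsWithin_iff.2 ⟨?_, Eventually.of_forall fun ε => ?_⟩
      · have : Continuous fun ε : ℝ => x + ε • (z - x) := by fun_prop
        simpa using this.tendsto 0
      · have := AffineMap.lineMap_mem ε (subset_affineSpan ℝ D hxD) (subset_affineSpan ℝ D hz)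
        rwa [AffineMap.lineMap_apply_module', add_comm] at this
    exact ht hn
  · rintro ⟨hx, h⟩
    obtain ⟨z, hz⟩ := Set.Nonempty.intrinsicInterior hD ⟨x, hx⟩
    obtain ⟨hzD, hn⟩ := hiff.1 hz
    obtain ⟨ε, hw, hε⟩ := (((h z hzD).filter_mono nhdsWithin_le_nhds).and
      (self_mem_nhdsWithin : Set.Iio (0 : ℝ) ∈ 𝓝[<] 0)).exists
    have hε : ε < 0 := hε
    have h1 : (0 : ℝ) < 1 - ε := by linarith
    refine hiff.2 ⟨hx, ?_⟩
    obtain ⟨w, hwdef⟩ : ∃ w, w = x + ε • (z - x) := ⟨_, rfl⟩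
    rw [← hwdef] at hw
    -- the homothety with center `w` and ratio `c` takes `x` to the interior point `z`
    let c : ℝ := 1 - ε⁻¹
    have hc1 : 1 < c := by
      have := inv_lt_zero.2 hε
      simp only [c]; linarith
    have hc0 : c ≠ 0 := by linarith
    have hgx : w + c • (x - w) = z := by
      have : x - w = (-ε) • (z - x) := by rw [hwdef]; module
      rw [this, hwdef, smul_smul]
      have : c * -ε = 1 - ε := by
        simp only [c]; field_simp [hε.ne]; ring
      rw [this]; module
    have ht : Tendsto (fun y : E => w + c • (y - w)) (𝓝[(affineSpan ℝ D : Set E)] x)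
        (𝓝[(affineSpan ℝ D : Set E)] z) := by
      refine tendsto_nhdsWithin_iff.2 ⟨?_, ?_⟩
      · have : Continuous fun y : E => w + c • (y - w) := by fun_prop
        have := this.tendsto x
        rw [hgx] at this
        exact this.mono_left nhdsWithin_le_nhds
      · filter_upwards [self_mem_nhdsWithin] with y hy
        have := AffineMap.lineMap_mem c (subset_affineSpan ℝ D hw) hy
        rwa [AffineMap.lineMap_apply_module', add_comm] at this
    filter_upwards [ht hn] with y hy
    have := hD hw hy (a := 1 - c⁻¹) (b := c⁻¹) (by
      rw [sub_nonneg]; exact inv_le_one_of_one_le₀ hc1.le) (by positivity) (by ring)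
    convert this using 1
    simp only [smul_add, smul_smul, inv_mul_cancel₀ hc0]
    module

theorem lineCombination_mem_intrinsicInterior [FiniteDimensional ℝ E] {D : Set E}
    (hD : Convex ℝ D) {x w : E} (hx : x ∈ intrinsicInterior ℝ D) (hw : w ∈ D) {t : ℝ}
    (h0 : 0 ≤ t) (h1 : t < 1) : (1 - t) • x + t • w ∈ intrinsicInterior ℝ D := by
  rw [mem_intrinsicInterior_iff_eventually hD] at hx ⊢
  refine ⟨hD hx.1 hw (by linarith) h0 (by ring), fun z hz => ?_⟩
  -- `p + ε (z - p)` is a convex combination of `w` and `x + δ (z - x)`, `δ = ε / ((1 - ε) (1 - t) + ε)`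
  have ht : Tendsto (fun ε : ℝ => ε / ((1 - ε) * (1 - t) + ε)) (𝓝 0) (𝓝 0) := by
    have : ContinuousAt (fun ε : ℝ => ε / ((1 - ε) * (1 - t) + ε)) 0 := by
      apply ContinuousAt.div (by fun_prop) (by fun_prop)
      simp; linarith
    simpa [ContinuousAt] using this
  have hpos : ∀ᶠ ε : ℝ in 𝓝 0, 0 < (1 - ε) * (1 - t) + ε := by
    have : Continuous fun ε : ℝ => (1 - ε) * (1 - t) + ε := by fun_prop
    exact (this.tendsto 0).eventually (lt_mem_nhds (by simp; linarith))
  have hlt : ∀ᶠ ε : ℝ in 𝓝 0, ε < 1 := gt_mem_nhds (by norm_num)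
  filter_upwards [ht.eventually (hx.2 z hz), hpos, hlt] with ε h2 h3 h4
  have := hD h2 hw h3.le (mul_nonneg (by linarith : 0 ≤ 1 - ε) h0) (by ring)
  convert this using 1
  rw [smul_add, smul_smul, mul_div_cancel₀ _ h3.ne']
  module

theorem convex_intrinsicInterior [FiniteDimensional ℝ E] {D : Set E} (hD : Convex ℝ D) :
    Convex ℝ (intrinsicInterior ℝ D) := by
  intro x hx w hw a b ha hb hab
  rcases hb.eq_or_lt with rfl | hb
  · obtain rfl : a = 1 := by linarith
    simpa using hx
  rcases ha.eq_or_lt with rfl | ha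
  · obtain rfl : b = 1 := by linarith
    simpa using hw
  obtain rfl : a = 1 - b := by linarith
  exact lineCombination_mem_intrinsicInterior hD hx (intrinsicInterior_subset hw) hb.le
    (by linarith)

theorem eventually_mem_intrinsicInterior [FiniteDimensional ℝ E] {D : Set E} (hD : Convex ℝ D)
    {x z : E} (hx : x ∈ intrinsicInterior ℝ D) (hz : z ∈ D) :
    ∀ᶠ ε : ℝ in 𝓝 0, x + ε • (z - x) ∈ intrinsicInterior ℝ D := by
  have h := ((mem_intrinsicInterior_iff_eventually hD).1 hx).2 z hz
  have ht : Tendsto (fun ε : ℝ => 2 * ε) (𝓝 0) (𝓝 0) := by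
    simpa using (continuous_const_mul (2 : ℝ)).tendsto 0
  filter_upwards [ht.eventually h] with ε hε
  have := lineCombination_mem_intrinsicInterior hD hx hε (t := 1 / 2) (by norm_num) (by norm_num)
  convert this using 1
  module

theorem relOpen_intrinsicInterior [FiniteDimensional ℝ E] {D : Set E} (hD : Convex ℝ D) :
    RelOpen (intrinsicInterior ℝ D) := fun _ hx _ hz =>
  eventually_mem_intrinsicInterior hD hx (intrinsicInterior_subset hz)

theorem vectorSpan_intrinsicInterior [FiniteDimensional ℝ E] {D : Set E} (hD : Convex ℝ D)
    (hne : D.Nonempty) : vectorSpan ℝ (intrinsicInterior ℝ D) = vectorSpan ℝ D := by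
  refine le_antisymm (vectorSpan_mono _ intrinsicInterior_subset) ?_
  obtain ⟨x, hx⟩ := hne.intrinsicInterior hD
  rw [vectorSpan_eq_span_vsub_set_right ℝ (intrinsicInterior_subset hx), Submodule.span_le]
  rintro _ ⟨z, hz, rfl⟩
  exact mem_vectorSpan_of_eventually hx (eventually_mem_intrinsicInterior hD hx hz)

end Interior

/-! ### Principal specializations of quasisymmetric functions -/

section QSym

/-- The indices of the variables `x₁, …, x_m`. -/
def firstVars (m : ℕ) : Finset ℕ+ :=
  (Finset.range m).map ⟨Nat.succPNat, Nat.succPNat_injective⟩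

theorem mem_firstVars {m : ℕ} {i : ℕ+} : i ∈ firstVars m ↔ (i : ℕ) ≤ m := by
  simp only [firstVars, Finset.mem_map, Finset.mem_range, Function.Embedding.coeFn_mk]
  constructor
  · rintro ⟨a, ha, rfl⟩
    simpa using ha
  · intro h
    exact ⟨i.natPred, by have := i.pos; rw [PNat.natPred]; omega, PNat.succPNat_natPred i⟩

theorem card_firstVars (m : ℕ) : (firstVars m).card = m := by simp [firstVars]

theorem sum_single_apply {k : ℕ} {i : Fin k → ℕ+} (hi : Function.Injective i) (c : Fin k → ℕ)
    (j : Fin k) : (∑ l, Finsupp.single (i l) (c l)) (i j) = c j := by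
  rw [Finsupp.finsetSum_apply, Finset.sum_eq_single j]
  · simp
  · intro l _ hl
    exact Finsupp.single_eq_of_ne fun h => hl (hi h.symm)
  · simp

theorem support_sum_single {k : ℕ} {i : Fin k → ℕ+} (hi : Function.Injective i) {c : Fin k → ℕ}
    (hc : ∀ j, 0 < c j) :
    (∑ l, Finsupp.single (i l) (c l)).support = Finset.univ.image i := by
  ext a
  constructor
  · intro ha
    obtain ⟨l, _, hl⟩ := Finset.mem_biUnion.1 (Finsupp.support_finsetSum ha)
    rw [Finset.mem_singleton.1 (Finsupp.support_single_subset hl)]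
    exact Finset.mem_image_of_mem _ (Finset.mem_univ _)
  · intro ha
    obtain ⟨l, _, rfl⟩ := Finset.mem_image.1 ha
    rw [Finsupp.mem_support_iff, sum_single_apply hi]
    exact (hc l).ne'

variable {R : Type*} [CommRing R]

theorem coeff_monomialQSym {n : ℕ} (α : Composition n) (d : ℕ+ →₀ ℕ)
    [Decidable (∃ i : Fin α.length → ℕ+, StrictMono i ∧
      d = ∑ j, Finsupp.single (i j) (α.blocksFun j))] :
    MvPowerSeries.coeff d (monomialQSym R α) =
      if ∃ i : Fin α.length → ℕ+, StrictMono i ∧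
        d = ∑ j, Finsupp.single (i j) (α.blocksFun j) then 1 else 0 := by
  change monomialQSym R α d = _
  simp only [monomialQSym]
  congr

theorem degree_eq_of_coeff_ne_zero {n : ℕ} {F : MvPowerSeries ℕ+ R} (hF : F ∈ QSym R n)
    {d : ℕ+ →₀ ℕ} (hd : MvPowerSeries.coeff d F ≠ 0) : d.degree = n := by
  by_contra hne
  apply hd
  induction hF using Submodule.span_induction with
  | mem F hF =>
    obtain ⟨α, rfl⟩ := hF
    classical
    rw [coeff_monomialQSym, if_neg]
    rintro ⟨i, _, rfl⟩
    apply hne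
    simp [map_sum, α.sum_blocksFun]
  | zero => simp
  | add F G _ _ hF hG =>
    rw [map_add]
    by_cases h : MvPowerSeries.coeff d F = 0
    · by_cases h' : MvPowerSeries.coeff d G = 0
      · rw [h, h', add_zero]
      · rw [h, hG h', add_zero]
    · by_cases h' : MvPowerSeries.coeff d G = 0
      · rw [hF h, h', add_zero]
      · rw [hF h, hG h', add_zero]
  | smul c F _ hF =>
    by_cases h : MvPowerSeries.coeff d F = 0
    · simp [h]
    · simp [hF h]

/-- Homogeneity leaves only finitely many monomials in `x₁, …, x_m`. Additivity of `specialize` on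
`QSym` rests on this, since a `finsum` with infinite support is `0` by default. -/
theorem specialize_eq_sum {n : ℕ} {F : MvPowerSeries ℕ+ R} (hF : F ∈ QSym R n) (m : ℕ) :
    specialize F m =
      ∑ d ∈ (firstVars m).finsuppAntidiag n, MvPowerSeries.coeff d F := by
  refine finsum_mem_eq_sum_of_inter_support_eq (s := {d : ℕ+ →₀ ℕ | ∀ i ∈ d.support, (i : ℕ) ≤ m})
    (fun d => MvPowerSeries.coeff d F) ?_
  ext d
  simp only [Set.mem_inter_iff, Set.mem_ofPred_eq, Function.mem_support, Finset.mem_coe,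
    Finset.mem_finsuppAntidiag, and_congr_left_iff]
  intro hd
  have hdeg := degree_eq_of_coeff_ne_zero hF hd
  constructor
  · intro h
    have hsub : d.support ⊆ firstVars m := fun i hi => mem_firstVars.2 (h i hi)
    refine ⟨?_, hsub⟩
    rw [← hdeg, Finsupp.degree_apply]
    exact (Finset.sum_subset hsub fun x _ hx => Finsupp.notMem_support_iff.1 hx).symm
  · rintro ⟨_, h⟩ i hi
    exact mem_firstVars.1 (h hi)

/-- A monomial of `M_α` is determined by its support, which can be any set of `α.length` variables:
the increasing enumeration of the set assigns the exponents. -/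
theorem specialize_monomialQSym {n : ℕ} (α : Composition n) (m : ℕ) :
    specialize (monomialQSym R α) m = (m.choose α.length : ℕ) := by
  classical
  rw [specialize_eq_sum (Submodule.subset_span ⟨α, rfl⟩)]
  simp only [coeff_monomialQSym]
  rw [Finset.sum_boole]
  congr 1
  rw [← card_firstVars m, ← Finset.card_powersetCard, card_firstVars]
  have hpos : ∀ j, 0 < α.blocksFun j := fun j => α.one_le_blocksFun j
  refine Finset.card_nbij (fun d => d.support) ?_ ?_ ?_
  · intro d hd
    simp only [Finset.coe_filter, Finset.mem_finsuppAntidiag, Set.mem_ofPred_eq] at hd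
    obtain ⟨⟨_, hsub⟩, i, hi, rfl⟩ := hd
    rw [Finset.mem_coe, Finset.mem_powersetCard]
    refine ⟨hsub, ?_⟩
    simp only
    rw [support_sum_single hi.injective hpos, Finset.card_image_of_injective _ hi.injective]
    simp
  · intro d hd d' hd' h
    simp only [Finset.coe_filter, Set.mem_ofPred_eq] at hd hd'
    obtain ⟨_, i, hi, rfl⟩ := hd
    obtain ⟨_, i', hi', rfl⟩ := hd'
    simp only at h
    rw [support_sum_single hi.injective hpos, support_sum_single hi'.injective hpos] at h
    have : i = i' := (StrictMono.range_inj hi hi').1 (by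
      simpa using congrArg (fun s : Finset ℕ+ => (s : Set ℕ+)) h)
    rw [this]
  · intro s hs
    rw [Finset.mem_coe, Finset.mem_powersetCard] at hs
    let i := s.orderEmbOfFin hs.2
    have himg : Finset.univ.image i = s := by
      rw [← Finset.coe_inj]
      simp [i]
    have hsupp := (support_sum_single i.injective hpos).trans himg
    refine ⟨∑ j, Finsupp.single (i j) (α.blocksFun j), ?_, hsupp⟩
    simp only [Finset.coe_filter, Finset.mem_finsuppAntidiag, Set.mem_ofPred_eq]
    refine ⟨⟨?_, hsupp.trans_subset hs.1⟩, i, i.strictMono, rfl⟩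
    rw [← Finset.sum_subset (hsupp.trans_subset hs.1)
      fun x _ hx => Finsupp.notMem_support_iff.1 hx]
    rw [hsupp, ← himg, Finset.sum_image fun a _ b _ h => i.injective h,
      Finset.sum_congr rfl fun j _ => sum_single_apply i.injective _ j, α.sum_blocksFun]

/-- `F` is quasisymmetric of degree `n`, and its principal specialization is a polynomial that
takes the value `c` at `-1`. -/
structure HasSpecialization (n : ℕ) (F : MvPowerSeries ℕ+ R) (c : R) : Prop where
  mem_QSym : F ∈ QSym R n
  exists_polynomial : ∃ p : R[X], (∀ m : ℕ, p.eval (m : R) = specialize F m) ∧ p.eval (-1) = c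

namespace HasSpecialization

variable {n : ℕ}

theorem zero : HasSpecialization n (0 : MvPowerSeries ℕ+ R) 0 :=
  ⟨zero_mem _, 0, fun m => by simp [specialize], by simp⟩

theorem add {F G : MvPowerSeries ℕ+ R} {a b : R} (hF : HasSpecialization n F a)
    (hG : HasSpecialization n G b) : HasSpecialization n (F + G) (a + b) := by
  obtain ⟨hF, p, hp, rfl⟩ := hF
  obtain ⟨hG, q, hq, rfl⟩ := hG
  refine ⟨add_mem hF hG, p + q, fun m => ?_, Polynomial.eval_add⟩
  rw [Polynomial.eval_add, hp, hq, specialize_eq_sum hF, specialize_eq_sum hG,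
    specialize_eq_sum (add_mem hF hG), ← Finset.sum_add_distrib]
  simp

theorem smul {F : MvPowerSeries ℕ+ R} {a : R} (c : R) (hF : HasSpecialization n F a) :
    HasSpecialization n (c • F) (c * a) := by
  obtain ⟨hF, p, hp, rfl⟩ := hF
  refine ⟨Submodule.smul_mem _ _ hF, Polynomial.C c * p, fun m => ?_, by simp⟩
  rw [Polynomial.eval_mul, Polynomial.eval_C, hp, specialize_eq_sum hF,
    specialize_eq_sum (Submodule.smul_mem _ _ hF), Finset.mul_sum]
  simp

theorem sum {ι : Type*} (s : Finset ι) {F : ι → MvPowerSeries ℕ+ R} {a : ι → R}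
    (h : ∀ i ∈ s, HasSpecialization n (F i) (a i)) :
    HasSpecialization n (∑ i ∈ s, F i) (∑ i ∈ s, a i) := by
  classical
  induction s using Finset.induction_on with
  | empty => simpa using zero
  | insert i s hi ih =>
    rw [Finset.sum_insert hi, Finset.sum_insert hi]
    exact (h i (Finset.mem_insert_self _ _)).add
      (ih fun j hj => h j (Finset.mem_insert_of_mem hj))

/-- The polynomial is `m (m - 1) ⋯ (m - k + 1) / k!`, whose numerator at `-1` is `(-1) ^ k * k!`. -/
theorem monomialQSym [Algebra ℚ R] (α : Composition n) :
    HasSpecialization n (ExtPerm.monomialQSym R α) ((-1) ^ α.length) := by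
  have hfac : algebraMap ℚ R (α.length.factorial : ℚ)⁻¹ * (α.length.factorial : R) = 1 := by
    rw [← map_natCast (algebraMap ℚ R), ← map_mul, inv_mul_cancel₀, map_one]
    exact_mod_cast α.length.factorial_ne_zero
  refine ⟨Submodule.subset_span ⟨α, rfl⟩,
    Polynomial.C (algebraMap ℚ R (α.length.factorial : ℚ)⁻¹) * descPochhammer R α.length,
    fun m => ?_, ?_⟩
  · rw [specialize_monomialQSym, Polynomial.eval_mul, Polynomial.eval_C,
      descPochhammer_eval_eq_descFactorial, Nat.descFactorial_eq_factorial_mul_choose,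
      Nat.cast_mul, ← mul_assoc, hfac, one_mul]
  · have h : ∀ k : ℕ, (descPochhammer R k).eval (-1) = (-1) ^ k * (k.factorial : R) := by
      intro k
      induction k with
      | zero => simp
      | succ k ih =>
        rw [descPochhammer_succ_eval, ih, Nat.factorial_succ]
        push_cast
        ring
    rw [Polynomial.eval_mul, Polynomial.eval_C, h, mul_left_comm, hfac, mul_one]

/-- Values on the infinite set `ℕ` determine a polynomial, so the choice made in `ps1` is harmless.
-/
theorem ps1_eval [IsDomain R] [CharZero R] {F : MvPowerSeries ℕ+ R} {c : R}
    (hF : HasSpecialization n F c) :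
    (∀ m : ℕ, (ps1 F).eval (m : R) = specialize F m) ∧ (ps1 F).eval (-1) = c := by
  obtain ⟨-, p, hp, rfl⟩ := hF
  have hex : ∃ p : R[X], ∀ m : ℕ, p.eval (m : R) = specialize F m := ⟨p, hp⟩
  have hps : ∀ m : ℕ, (ps1 F).eval (m : R) = specialize F m := by
    rw [ps1, dif_pos hex]
    exact hex.choose_spec
  refine ⟨hps, ?_⟩
  rw [Polynomial.eq_of_infinite_eval_eq (ps1 F) p
    ((Set.infinite_range_of_injective (Nat.cast_injective (R := R))).mono ?_)]
  rintro _ ⟨m, rfl⟩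
  exact (hps m).trans (hp m).symm

end HasSpecialization

end QSym

/-! ### Braid cells -/

section Cells

variable {n k : ℕ}

/-- The relatively open braid cone of an ordered set partition, given by the map `f` from elements
to blocks. -/
def orderCell (f : Fin n → Fin k) : Set (Fin n → ℝ) := {y | ∀ i j, y i ≤ y j ↔ f i ≤ f j}

/-- Used with `L = ℝ` for the direction space of a cell and with `L = ℕ+` for its lattice points. -/
theorem exists_strictMono_comp {L : Type*} [LinearOrder L] {f : Fin n → Fin k}
    (hf : Function.Surjective f) {y : Fin n → L} (hy : ∀ i j, y i ≤ y j ↔ f i ≤ f j) :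
    ∃ e : Fin k → L, StrictMono e ∧ y = e ∘ f := by
  refine ⟨fun a => y (Function.surjInv hf a), fun a b hab => ?_, funext fun i => ?_⟩
  · rw [← not_le, hy, Function.surjInv_eq hf, Function.surjInv_eq hf, not_le]
    exact hab
  · refine le_antisymm ?_ ?_ <;> simp [hy, Function.surjInv_eq]

theorem comp_mem_orderCell (f : Fin n → Fin k) {e : Fin k → ℝ} (he : StrictMono e) :
    e ∘ f ∈ orderCell f := fun _ _ => he.le_iff_le

theorem strictMono_coe_fin : StrictMono fun a : Fin k => ((a : ℕ) : ℝ) :=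
  fun _ _ h => Nat.cast_lt.2 h

theorem exists_composition (x : Fin n → ℝ) :
    ∃ (α : Composition n) (f : Fin n → Fin α.length), x ∈ orderCell f ∧
      ∀ j, α.blocksFun j = (Finset.univ.filter fun i => f i = j).card := by
  classical
  let s := Finset.univ.image x
  let e := s.orderIsoOfFin rfl
  have hx : ∀ i, x i ∈ s := fun i => Finset.mem_image_of_mem _ (Finset.mem_univ i)
  -- The block of `i` is the rank of `x i` among the distinct values of `x`.
  let f : Fin n → Fin s.card := fun i => e.symm ⟨x i, hx i⟩
  have hmono : ∀ i j, x i ≤ x j ↔ f i ≤ f j := fun i j => by simp [f]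
  have hsurj : Function.Surjective f := fun a => by
    obtain ⟨i, _, hi⟩ := Finset.mem_image.1 (e a).2
    exact ⟨i, by simp [f, hi]⟩
  let c : Fin s.card → ℕ := fun j => (Finset.univ.filter fun i => f i = j).card
  let α : Composition n :=
    { blocks := List.ofFn c
      blocks_pos := by
        intro a ha
        obtain ⟨j, rfl⟩ := (List.mem_ofFn' _ _).1 ha
        obtain ⟨i, hi⟩ := hsurj j
        exact Finset.card_pos.2 ⟨i, by simp [hi]⟩
      blocks_sum := by
        rw [List.sum_ofFn]
        simp only [c]
        rw [← Finset.card_eq_sum_card_fiberwise fun _ _ => Finset.mem_univ _]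
        simp }
  have hlen : s.card = α.length := by simp [α, Composition.length]
  refine ⟨α, fun i => Fin.cast hlen (f i), fun i j => by simpa using hmono i j, fun j => ?_⟩
  have : α.blocksFun j = c (Fin.cast hlen.symm j) := by
    simp only [α, Composition.blocksFun, List.get_eq_getElem, List.getElem_ofFn]
    rfl
  rw [this]
  simp only [c]
  congr 1
  ext i
  simp [Fin.ext_iff]

/-- The positive lattice points of the cell are the maps `e ∘ f` with `e` strictly increasing. The
support of the monomial recovers `e`, so all coefficients are `0` or `1`. -/
theorem latticeEnumerator_orderCell (R : Type*) [CommRing R] {α : Composition n}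
    {f : Fin n → Fin α.length}
    (hf : ∀ j, α.blocksFun j = (Finset.univ.filter fun i => f i = j).card) :
    latticeEnumerator R (orderCell f) = monomialQSym R α := by
  classical
  have hpos : ∀ j, 0 < α.blocksFun j := fun j => α.one_le_blocksFun j
  have hsurj : Function.Surjective f := fun j => by
    obtain ⟨i, hi⟩ := Finset.card_pos.1 ((hf j).symm ▸ hpos j)
    exact ⟨i, (Finset.mem_filter.1 hi).2⟩
  have hsum : ∀ e : Fin α.length → ℕ+,
      ∑ i, Finsupp.single ((e ∘ f) i) 1 = ∑ j, Finsupp.single (e j) (α.blocksFun j) := by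
    intro e
    rw [← Finset.sum_fiberwise Finset.univ f]
    refine Finset.sum_congr rfl fun j _ => ?_
    rw [Finset.sum_congr rfl (g := fun _ => Finsupp.single (e j) 1) fun i hi => by
      rw [Function.comp_apply, (Finset.mem_filter.1 hi).2], Finset.sum_const, hf j]
    simp
  have hcell : ∀ ω : Fin n → ℕ+, (fun i => ((ω i : ℕ) : ℝ)) ∈ orderCell f ↔
      ∃ e : Fin α.length → ℕ+, StrictMono e ∧ ω = e ∘ f := by
    intro ω
    constructor
    · intro h
      exact exists_strictMono_comp hsurj fun i j => by simpa using h i j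
    · rintro ⟨e, he, rfl⟩ i j
      simp [he.le_iff_le]
  funext d
  simp only [latticeEnumerator, monomialQSym, hcell]
  split_ifs with h
  · obtain ⟨e, he, rfl⟩ := h
    rw [Set.ncard_eq_one.2, Nat.cast_one]
    refine ⟨e ∘ f, Set.eq_singleton_iff_unique_mem.2 ⟨⟨⟨e, he, rfl⟩, hsum e⟩, ?_⟩⟩
    rintro _ ⟨⟨e', he', rfl⟩, h⟩
    rw [hsum] at h
    have h' := congrArg Finsupp.support h
    rw [support_sum_single he.injective hpos, support_sum_single he'.injective hpos] at h'
    rw [(StrictMono.range_inj he' he).1 (by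
      simpa using congrArg (fun s : Finset ℕ+ => (s : Set ℕ+)) h')]
  · suffices hs : {ω : Fin n → ℕ+ | (∃ e : Fin α.length → ℕ+, StrictMono e ∧ ω = e ∘ f) ∧
        ∑ i, Finsupp.single (ω i) 1 = d} = ∅ by
      rw [hs, Set.ncard_empty, Nat.cast_zero]
    refine Set.eq_empty_of_forall_notMem ?_
    rintro _ ⟨⟨e, he, rfl⟩, h'⟩
    exact h ⟨e, he, by rw [← h', hsum]⟩

theorem le_iff_of_sign_sub_eq {a b c d : ℝ} (h : SignType.sign (a - b) = SignType.sign (c - d)) :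
    a ≤ b ↔ c ≤ d := by
  rw [← sub_nonpos, ← sign_nonpos_iff, h, sign_nonpos_iff, sub_nonpos]

theorem sign_sub_eq {x y : Fin n → ℝ} (h : ∀ i j, x i ≤ x j ↔ y i ≤ y j) (i j : Fin n) :
    SignType.sign (x i - x j) = SignType.sign (y i - y j) := by
  rcases lt_trichotomy (x i) (x j) with hx | hx | hx
  · have hy : y i < y j := by rwa [← not_le, ← h, not_le]
    rw [sign_neg (sub_neg.2 hx), sign_neg (sub_neg.2 hy)]
  · have hy : y i = y j := le_antisymm ((h i j).1 hx.le) ((h j i).1 hx.ge)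
    rw [hx, hy, sub_self, sub_self]
  · have hy : y j < y i := by rwa [← not_le, ← h, not_le]
    rw [sign_pos (sub_pos.2 hx), sign_pos (sub_pos.2 hy)]

/-- The cell is open in the space of vectors constant on the blocks: small changes of the block
values preserve their strict order. -/
theorem vectorSpan_orderCell {f : Fin n → Fin k} (hf : Function.Surjective f) :
    vectorSpan ℝ (orderCell f) = LinearMap.range (LinearMap.funLeft ℝ ℝ f) := by
  have hx := comp_mem_orderCell f strictMono_coe_fin
  refine le_antisymm ?_ ?_
  · rw [vectorSpan_eq_span_vsub_set_right ℝ hx, Submodule.span_le]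
    rintro _ ⟨z, hz, rfl⟩
    obtain ⟨e, -, rfl⟩ := exists_strictMono_comp hf hz
    exact ⟨e - fun a : Fin k => ((a : ℕ) : ℝ), rfl⟩
  · rintro _ ⟨v, rfl⟩
    refine mem_vectorSpan_of_eventually hx ?_
    have hev : ∀ i j, ∀ᶠ ε : ℝ in 𝓝 0,
        SignType.sign ((((f i : ℕ) : ℝ) - ((f j : ℕ) : ℝ)) + ε * (v (f i) - v (f j))) =
          SignType.sign (((f i : ℕ) : ℝ) - ((f j : ℕ) : ℝ)) := fun i j =>
      eventually_sign_add_mul fun h0 => by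
        rw [sub_eq_zero, Nat.cast_inj] at h0
        rw [Fin.ext h0, sub_self]
    filter_upwards [eventually_all.2 fun i => eventually_all.2 (hev i)] with ε hε i j
    rw [← hx i j]
    apply le_iff_of_sign_sub_eq
    rw [Function.comp_apply, Function.comp_apply, ← hε i j]
    congr 1
    simp only [Pi.add_apply, Pi.smul_apply, LinearMap.funLeft_apply, smul_eq_mul,
      Function.comp_apply]
    ring

theorem eulerChar_orderCell (R : Type*) [CommRing R] {f : Fin n → Fin k}
    (hf : Function.Surjective f) : eulerChar R (orderCell f) = (-1) ^ k := by
  rw [eulerChar_eq R (comp_mem_orderCell f strictMono_coe_fin) (vectorSpan_orderCell hf),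
    LinearMap.finrank_range_of_inj (LinearMap.funLeft_injective_of_surjective _ _ _ hf)]
  simp

end Cells

/-! ### Unions of braid cells -/

section Braid

variable {n : ℕ}

theorem mem_braidCone_of_order {C : Set (Fin n → ℝ)} (hC : C ∈ braidFan n) {x y : Fin n → ℝ}
    (hx : x ∈ C) (h : ∀ i j, x i ≤ x j → y i ≤ y j) : y ∈ C := by
  obtain ⟨F, rfl⟩ := hC
  exact ⟨fun i p hp q hq => le_antisymm (h _ _ (hx.1 i p hp q hq).le) (h _ _ (hx.1 i p hp q hq).ge),
    fun i j hij p hp q hq => h _ _ (hx.2 i j hij p hp q hq)⟩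

/-- For small `ε`, every weak inequality between coordinates of `x + ε • (z - x)` also holds for `y
+ ε • (z - y)`: strict inequalities survive, and ties are broken by `z` in the same way. So `hinv`
transfers the segment criterion from `x` to `y`. -/
theorem mem_intrinsicInterior_of_order {D : Set (Fin n → ℝ)} (hD : Convex ℝ D)
    (hinv : ∀ x ∈ D, ∀ y : Fin n → ℝ, (∀ i j, x i ≤ x j → y i ≤ y j) → y ∈ D)
    {x y : Fin n → ℝ} (hx : x ∈ intrinsicInterior ℝ D) (h : ∀ i j, x i ≤ x j ↔ y i ≤ y j) :
    y ∈ intrinsicInterior ℝ D := by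
  rw [mem_intrinsicInterior_iff_eventually hD] at hx ⊢
  refine ⟨hinv x hx.1 y fun i j => (h i j).1, fun z hz => ?_⟩
  have key : ∀ i j, ∀ᶠ ε : ℝ in 𝓝 0,
      (x + ε • (z - x)) i ≤ (x + ε • (z - x)) j → (y + ε • (z - y)) i ≤ (y + ε • (z - y)) j := by
    intro i j
    have hcont : ∀ (u : Fin n → ℝ) (l : Fin n),
        Tendsto (fun ε : ℝ => (u + ε • (z - u)) l) (𝓝 0) (𝓝 (u l)) := fun u l => by
      have : Continuous fun ε : ℝ => (u + ε • (z - u)) l := by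
        simp only [Pi.add_apply, Pi.smul_apply, smul_eq_mul]
        fun_prop
      simpa using this.tendsto 0
    rcases lt_trichotomy (x i) (x j) with hij | hij | hij
    · have hy : y i < y j := by rwa [← not_le, ← h, not_le]
      filter_upwards [(hcont y i).eventually_lt (hcont y j) hy] with ε hε _ using hε.le
    · have hy : y i = y j := le_antisymm ((h i j).1 hij.le) ((h j i).1 hij.ge)
      refine Eventually.of_forall fun ε hε => ?_
      simp only [Pi.add_apply, Pi.smul_apply, Pi.sub_apply, smul_eq_mul] at hε ⊢
      rw [hij] at hε
      rw [hy]
      linarith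
    · filter_upwards [(hcont x j).eventually_lt (hcont x i) hij] with ε hε h'
      exact absurd h' (not_le.2 hε)
  filter_upwards [hx.2 z hz, eventually_all.2 fun i => eventually_all.2 (key i)] with ε h1 h2
  exact hinv _ h1 _ h2

theorem finite_weights (d : ℕ+ →₀ ℕ) :
    {ω : Fin n → ℕ+ | ∑ i, Finsupp.single (ω i) 1 = d}.Finite := by
  refine (Set.Finite.pi' fun _ : Fin n => d.support.finite_toSet).subset ?_
  rintro ω rfl i
  rw [Finset.mem_coe, Finsupp.mem_support_iff, Finsupp.finsetSum_apply]
  refine (Finset.sum_pos' (fun _ _ => Nat.zero_le _) ⟨i, Finset.mem_univ i, ?_⟩).ne'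
  simp

theorem latticeEnumerator_eq_sum (R : Type*) [CommRing R] {σ : Type*} [Fintype σ]
    (A : Set (Fin n → ℝ)) (g : (Fin n → ℝ) → σ) :
    latticeEnumerator R A = ∑ s, latticeEnumerator R (A ∩ {x | g x = s}) := by
  classical
  ext d
  rw [map_sum]
  simp only [MvPowerSeries.coeff_apply, latticeEnumerator]
  have hfin : ∀ B : Set (Fin n → ℝ), {ω : Fin n → ℕ+ | (fun i => ((ω i : ℕ) : ℝ)) ∈ B ∧
      ∑ i, Finsupp.single (ω i) 1 = d}.Finite := fun B =>
    (finite_weights d).subset fun _ h => h.2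
  rw [← Nat.cast_sum, Set.ncard_eq_toFinset_card _ (hfin A),
    Finset.card_eq_sum_card_fiberwise (f := fun ω : Fin n → ℕ+ => g fun i => ((ω i : ℕ) : ℝ))
      (t := Finset.univ) fun _ _ => Finset.mem_coe.2 (Finset.mem_univ _)]
  congr 1
  refine Finset.sum_congr rfl fun s _ => ?_
  rw [Set.ncard_eq_toFinset_card _ (hfin _)]
  congr 1
  ext ω
  simp only [Finset.mem_filter, Set.Finite.mem_toFinset, Set.mem_ofPred_eq, Set.mem_inter_iff]
  tauto

theorem latticeEnumerator_empty (R : Type*) [CommRing R] :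
    latticeEnumerator R (∅ : Set (Fin n → ℝ)) = 0 := by
  funext d
  change _ = (0 : R)
  simp [latticeEnumerator]

/-- The lattice point enumerator of a relatively open convex union of braid cells. -/
theorem hasSpecialization_latticeEnumerator (R : Type*) [CommRing R] [Algebra ℚ R]
    {A : Set (Fin n → ℝ)} (hA : RelOpen A) (hc : Convex ℝ A)
    (hinv : ∀ x ∈ A, ∀ y : Fin n → ℝ, (∀ i j, x i ≤ x j ↔ y i ≤ y j) → y ∈ A) :
    HasSpecialization n (latticeEnumerator R A) (eulerChar R A) := by
  let h : Fin n × Fin n → (Fin n → ℝ) →ₗ[ℝ] ℝ := fun p =>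
    LinearMap.proj (R := ℝ) (φ := fun _ : Fin n => ℝ) p.1 - LinearMap.proj p.2
  rw [← sum_eulerChar_cells R h hA hc,
    latticeEnumerator_eq_sum R A fun x p => SignType.sign (h p x)]
  refine HasSpecialization.sum _ fun s _ => ?_
  simp only [funext_iff]
  rcases (A ∩ {x | ∀ p, SignType.sign (h p x) = s p}).eq_empty_or_nonempty with he | ⟨x, hx, hxs⟩
  · rw [he, latticeEnumerator_empty]
    simpa [eulerChar] using HasSpecialization.zero
  · obtain ⟨α, f, hxf, hcard⟩ := exists_composition x
    have hsurj : Function.Surjective f := fun j => by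
      obtain ⟨i, hi⟩ := Finset.card_pos.1 ((hcard j).symm ▸ α.one_le_blocksFun j)
      exact ⟨i, (Finset.mem_filter.1 hi).2⟩
    -- The signs of all differences of coordinates fix the weak order, and `hinv` puts the whole
    -- cell of `x` inside `A`.
    have hcell : A ∩ {x | ∀ p, SignType.sign (h p x) = s p} = orderCell f := by
      ext y
      constructor
      · rintro ⟨-, hy⟩ i j
        rw [← hxf i j]
        exact le_iff_of_sign_sub_eq ((hy (i, j)).trans (hxs (i, j)).symm)
      · intro hy
        have hxy : ∀ i j, x i ≤ x j ↔ y i ≤ y j := fun i j => (hxf i j).trans (hy i j).symm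
        exact ⟨hinv x hx y hxy, fun p => (sign_sub_eq hxy p.1 p.2).symm.trans (hxs p)⟩
    rw [hcell, latticeEnumerator_orderCell R hcard, eulerChar_orderCell R hsurj]
    exact HasSpecialization.monomialQSym α

end Braid

/-! ### Faces and normal cones of polyhedra -/

section Polyhedron

variable {n k : ℕ} {a : Fin k → Fin n → ℝ} {b : Fin k → ℝ} {G : Set (Fin n → ℝ)}

/-- The constraints that hold with equality on `G`. -/
def activeSet (a : Fin k → Fin n → ℝ) (b : Fin k → ℝ) (G : Set (Fin n → ℝ)) : Set (Fin k) :=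
  {i | ∀ x ∈ G, a i ⬝ᵥ x = b i}

/-- Each inactive constraint is strict somewhere on `G`, and taking midpoints preserves strictness
already achieved. -/
theorem exists_strict_point (hG : G ∈ faces {x | ∀ i, a i ⬝ᵥ x ≤ b i}) :
    ∃ x ∈ G, ∀ i ∉ activeSet a b G, a i ⬝ᵥ x < b i := by
  classical
  obtain ⟨⟨x₀, hx₀⟩, hexp⟩ := hG
  have hle : ∀ x ∈ G, ∀ i, a i ⬝ᵥ x ≤ b i := fun x hx => hexp.subset hx
  have hconv : Convex ℝ {x : Fin n → ℝ | ∀ i, a i ⬝ᵥ x ≤ b i} := by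
    intro x hx y hy s t hs ht hst i
    rw [dotProduct_add, dotProduct_smul, dotProduct_smul, smul_eq_mul, smul_eq_mul]
    calc s * (a i ⬝ᵥ x) + t * (a i ⬝ᵥ y) ≤ s * b i + t * b i :=
          add_le_add (mul_le_mul_of_nonneg_left (hx i) hs) (mul_le_mul_of_nonneg_left (hy i) ht)
      _ = b i := by rw [← add_mul, hst, one_mul]
  have hGc : Convex ℝ G := hexp.convex hconv
  suffices h : ∀ s : Finset (Fin k), ∃ x ∈ G, ∀ i ∈ s, i ∉ activeSet a b G → a i ⬝ᵥ x < b i by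
    obtain ⟨x, hx, h⟩ := h Finset.univ
    exact ⟨x, hx, fun i => h i (Finset.mem_univ i)⟩
  intro s
  induction s using Finset.induction_on with
  | empty => exact ⟨x₀, hx₀, by simp⟩
  | insert j s _ ih =>
    obtain ⟨x, hx, hxs⟩ := ih
    by_cases hj : j ∈ activeSet a b G
    · refine ⟨x, hx, fun i hi hia => ?_⟩
      rcases Finset.mem_insert.1 hi with rfl | hi
      · exact absurd hj hia
      · exact hxs i hi hia
    · obtain ⟨y, hy, hyj⟩ : ∃ y ∈ G, a j ⬝ᵥ y ≠ b j := by
        simpa [activeSet] using hj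
      have hyj := lt_of_le_of_ne (hle y hy j) hyj
      refine ⟨(1 / 2 : ℝ) • x + (1 / 2 : ℝ) • y,
        hGc hx hy (by norm_num) (by norm_num) (by norm_num), fun i hi hia => ?_⟩
      rw [dotProduct_add, dotProduct_smul, dotProduct_smul, smul_eq_mul, smul_eq_mul]
      have h1 := hle x hx i
      have h2 := hle y hy i
      rcases Finset.mem_insert.1 hi with rfl | hi
      · linarith
      · linarith [hxs i hi hia]

theorem eventually_mem_face (hG : G ∈ faces {x | ∀ i, a i ⬝ᵥ x ≤ b i}) :
    ∃ x ∈ G, ∀ v : Fin n → ℝ, (∀ i ∈ activeSet a b G, a i ⬝ᵥ v = 0) →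
      (∀ᶠ ε : ℝ in 𝓝 0, x + ε • v ∈ G) ∧ (x + v ∈ {x | ∀ i, a i ⬝ᵥ x ≤ b i} → x + v ∈ G) := by
  obtain ⟨x, hx, hstrict⟩ := exists_strict_point hG
  obtain ⟨-, hexp⟩ := hG
  obtain ⟨l, hl⟩ := hexp ⟨x, hx⟩
  have hxG : x ∈ {x ∈ {x | ∀ i, a i ⬝ᵥ x ≤ b i} | ∀ y ∈ {x | ∀ i, a i ⬝ᵥ x ≤ b i}, l y ≤ l x} := by
    rwa [← hl]
  refine ⟨x, hx, fun v hv => ?_⟩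
  have hP : ∀ᶠ ε : ℝ in 𝓝 0, x + ε • v ∈ {x | ∀ i, a i ⬝ᵥ x ≤ b i} := by
    refine eventually_all.2 fun i => ?_
    by_cases hi : i ∈ activeSet a b G
    · refine Eventually.of_forall fun ε => ?_
      rw [dotProduct_add, dotProduct_smul, hv i hi, smul_zero, add_zero, hi x hx]
    · have : Continuous fun ε : ℝ => a i ⬝ᵥ x + ε * (a i ⬝ᵥ v) := by fun_prop
      filter_upwards [(this.tendsto 0).eventually
        (gt_mem_nhds (show a i ⬝ᵥ x + 0 * (a i ⬝ᵥ v) < b i by simpa using hstrict i hi))] with ε hε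
      rw [dotProduct_add, dotProduct_smul, smul_eq_mul]
      exact hε.le
  -- One can move from `x` within the polyhedron along both `v` and `-v`, while `l` is maximal at
  -- `x`.
  have hl0 : l v = 0 := by
    obtain ⟨ε, hε, hpos⟩ := ((hP.filter_mono nhdsWithin_le_nhds).and
      (self_mem_nhdsWithin : Set.Ioi (0 : ℝ) ∈ 𝓝[>] 0)).exists
    obtain ⟨δ, hδ, hneg⟩ := ((hP.filter_mono nhdsWithin_le_nhds).and
      (self_mem_nhdsWithin : Set.Iio (0 : ℝ) ∈ 𝓝[<] 0)).exists
    have h1 := hxG.2 _ hε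
    have h2 := hxG.2 _ hδ
    rw [map_add, map_smul, smul_eq_mul, add_le_iff_nonpos_right] at h1 h2
    exact le_antisymm (nonpos_of_mul_nonpos_right h1 hpos) (nonneg_of_mul_nonpos_right h2 hneg)
  have hlift : ∀ w, l w = 0 → x + w ∈ {x | ∀ i, a i ⬝ᵥ x ≤ b i} → x + w ∈ G := by
    intro w hw hmem
    rw [hl]
    exact ⟨hmem, fun y hy => by rw [map_add, hw, add_zero]; exact hxG.2 y hy⟩
  exact ⟨hP.mono fun ε hε => hlift _ (by simp [hl0]) hε, hlift v hl0⟩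

theorem face_eq_of_active (hG : G ∈ faces {x | ∀ i, a i ⬝ᵥ x ≤ b i}) :
    G = {x | (∀ i, a i ⬝ᵥ x ≤ b i) ∧ ∀ i ∈ activeSet a b G, a i ⬝ᵥ x = b i} := by
  ext y
  refine ⟨fun hy => ⟨hG.2.subset hy, fun i hi => hi y hy⟩, fun hy => ?_⟩
  obtain ⟨x, hx, h⟩ := eventually_mem_face hG
  have := (h (y - x) fun i hi => by rw [dotProduct_sub, hy.2 i hi, hi x hx, sub_self]).2
  rw [add_sub_cancel] at this
  exact this hy.1

theorem IsPolyhedron.finite_faces {P : Set (Fin n → ℝ)} (hP : IsPolyhedron P) :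
    (faces P).Finite := by
  obtain ⟨k, a, b, rfl⟩ := hP
  refine (Set.finite_range fun I : Set (Fin k) =>
    {x | (∀ i, a i ⬝ᵥ x ≤ b i) ∧ ∀ i ∈ I, a i ⬝ᵥ x = b i}).subset fun G hG => ?_
  exact ⟨activeSet a b G, (face_eq_of_active hG).symm⟩

theorem convex_normalCone (P G : Set (Fin n → ℝ)) : Convex ℝ (normalCone P G) := by
  intro u hu v hv s t hs ht _ x hx y hy
  simp only [add_dotProduct, smul_dotProduct, smul_eq_mul]
  exact add_le_add (mul_le_mul_of_nonneg_left (hu x hx y hy) hs)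
    (mul_le_mul_of_nonneg_left (hv x hx y hy) ht)

theorem zero_mem_normalCone (P G : Set (Fin n → ℝ)) : (0 : Fin n → ℝ) ∈ normalCone P G :=
  fun x _ y _ => by simp

/-- The direction space of `G` is the orthogonal complement of the span of the normal cone. Weights
in the cone are constant on `G`. Conversely, the active normals `a i` lie in the cone, so a vector
orthogonal to it satisfies `eventually_mem_face`. -/
theorem IsPolyhedron.dim_add_dim_normalCone {P : Set (Fin n → ℝ)} (hP : IsPolyhedron P)
    (hG : G ∈ faces P) : dim G + dim (normalCone P G) = n := by
  obtain ⟨k, a, b, rfl⟩ := hP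
  let B := Matrix.toBilin' (1 : Matrix (Fin n) (Fin n) ℝ)
  have hB : B.Nondegenerate := LinearMap.BilinForm.nondegenerate_toBilin'_of_det_ne_zero' _ (by simp)
  have hBapp : ∀ u v, B u v = u ⬝ᵥ v := fun u v => by simp [B, Matrix.toBilin'_apply']
  set S := vectorSpan ℝ (normalCone {x | ∀ i, a i ⬝ᵥ x ≤ b i} G) with hS
  have hspan : vectorSpan ℝ G = B.orthogonal S := by
    refine le_antisymm ?_ fun v hv => ?_
    · refine Submodule.span_le.2 ?_
      rintro _ ⟨x, hx, y, hy, rfl⟩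
      rw [SetLike.mem_coe, LinearMap.BilinForm.mem_orthogonal_iff]
      intro s hs
      rw [hBapp]
      induction hs using Submodule.span_induction with
      | mem s hs =>
        obtain ⟨u, hu, w, hw, rfl⟩ := hs
        have hxP := hG.2.subset hx
        have hyP := hG.2.subset hy
        have h1 := le_antisymm (hu x hx y hyP) (hu y hy x hxP)
        have h2 := le_antisymm (hw x hx y hyP) (hw y hy x hxP)
        simp only [vsub_eq_sub, sub_dotProduct, dotProduct_sub]
        linarith
      | zero => simp
      | add s t _ _ h1 h2 => rw [add_dotProduct, h1, h2, add_zero]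
      | smul c s _ h => rw [smul_dotProduct, h, smul_zero]
    · obtain ⟨x, hx, h⟩ := eventually_mem_face hG
      refine mem_vectorSpan_of_eventually hx (h v fun i hi => ?_).1
      have hmem : a i ∈ normalCone {x | ∀ i, a i ⬝ᵥ x ≤ b i} G := fun x hx y hy => by
        rw [hi x hx]
        exact hy i
      have := vsub_mem_vectorSpan ℝ hmem (zero_mem_normalCone _ _)
      rw [vsub_eq_sub, sub_zero] at this
      rw [← hBapp]
      exact LinearMap.BilinForm.mem_orthogonal_iff.1 hv _ this
  have h1 : dim G = n - Module.finrank ℝ S := by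
    rw [dim, hspan, LinearMap.BilinForm.finrank_orthogonal hB]
    simp
  have h2 : Module.finrank ℝ S ≤ n := by simpa using Submodule.finrank_le S
  rw [h1, dim, ← hS]
  omega

theorem dim_le_of_mem_faces {P : Set (Fin n → ℝ)} (hG : G ∈ faces P) : dim G ≤ dim P :=
  Submodule.finrank_mono (vectorSpan_mono ℝ hG.2.subset)

theorem fPolynomial_eq_sum {P : Set (Fin n → ℝ)} (hfin : (faces P).Finite) :
    fPolynomial P = ∑ G ∈ hfin.toFinset, (Polynomial.X : ℚ[X]) ^ dim G := by
  classical
  rw [← Finset.sum_fiberwise_of_maps_to (t := Finset.range (dim P + 1)) (g := dim) fun G hG =>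
    Finset.mem_range.2 (Nat.lt_succ_of_le (dim_le_of_mem_faces (hfin.mem_toFinset.1 hG)))]
  refine Finset.sum_congr rfl fun i _ => ?_
  rw [Finset.sum_congr rfl (g := fun _ => (Polynomial.X : ℚ[X]) ^ i) fun G hG => by
    rw [(Finset.mem_filter.1 hG).2], Finset.sum_const, nsmul_eq_mul, map_natCast]
  congr 2
  rw [← Set.ncard_coe_finset]
  congr 1
  ext G
  simp

end Polyhedron

/-! ### The contribution of a face, and the sum over all faces -/

theorem IsExtendedGeneralizedPermutohedron.hasSpecialization_faceEnumerator {R : Type*}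
    [CommRing R] [Algebra ℚ R] (t : R) {n : ℕ} {P G : Set (Fin n → ℝ)}
    (hP : IsExtendedGeneralizedPermutohedron P) (hG : G ∈ faces P) :
    HasSpecialization n (faceEnumerator t P G) ((-1) ^ n * (-t) ^ dim G) := by
  obtain ⟨hpoly, -, S, hS, -, hcov⟩ := hP
  obtain ⟨T, hT, hD⟩ := hcov (normalCone P G) ⟨G, hG, rfl⟩
  have hc := convex_normalCone P G
  have hne : (normalCone P G).Nonempty := ⟨0, zero_mem_normalCone P G⟩
  -- The braid hypothesis enters here: the normal cone is a union of closed braid cones, each cut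
  -- out by weak inequalities between coordinates.
  have hinv : ∀ x ∈ normalCone P G, ∀ y : Fin n → ℝ, (∀ i j, x i ≤ x j → y i ≤ y j) →
      y ∈ normalCone P G := by
    rw [hD]
    rintro x ⟨C, hC, hx⟩ y hxy
    exact ⟨C, hC, mem_braidCone_of_order (hS.1 (hT hC)) hx hxy⟩
  have h := (hasSpecialization_latticeEnumerator R (relOpen_intrinsicInterior hc)
    (convex_intrinsicInterior hc)
    fun x hx y hxy => mem_intrinsicInterior_of_order hc hinv hx hxy).smul (t ^ dim G)
  obtain ⟨x, hx⟩ := hne.intrinsicInterior hc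
  rw [eulerChar_eq R hx (vectorSpan_intrinsicInterior hc hne)] at h
  have hdim : dim G + Module.finrank ℝ (vectorSpan ℝ (normalCone P G)) = n :=
    hpoly.dim_add_dim_normalCone hG
  have hsq : ((-1 : R) ^ dim G) * (-1) ^ dim G = 1 := by
    rw [← mul_pow, neg_one_mul, neg_neg, one_pow]
  rw [faceEnumerator]
  convert h using 1
  rw [neg_pow t]
  rw [show ((-1 : R)) ^ n = (-1) ^ (dim G + _) from congrArg _ hdim.symm, pow_add]
  linear_combination ((-1 : R) ^ Module.finrank ℝ (vectorSpan ℝ (normalCone P G)) * t ^ dim G) * hsq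

end ExtPerm

theorem proposition3p4 (n : ℕ) (P : Set (Fin n → ℝ))
    (hP : ExtPerm.IsExtendedGeneralizedPermutohedron P) :
    ExtPerm.enumerator (-Polynomial.X : ℚ[X]) P ∈ ExtPerm.QSym ℚ[X] n ∧
    (∀ m : ℕ, (ExtPerm.ps1 (ExtPerm.enumerator (-Polynomial.X : ℚ[X]) P)).eval (m : ℚ[X]) =
      ExtPerm.specialize (ExtPerm.enumerator (-Polynomial.X : ℚ[X]) P) m) ∧
    ExtPerm.fPolynomial P =
      (-1) ^ n * (ExtPerm.ps1 (ExtPerm.enumerator (-Polynomial.X : ℚ[X]) P)).eval (-1) := by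
  have hfin := hP.1.finite_faces
  -- At `t = -X` the factor `(-t) ^ dim G` is `X ^ dim G`, the term of `G` in the `f`-polynomial.
  have h : ExtPerm.HasSpecialization n (ExtPerm.enumerator (-Polynomial.X : ℚ[X]) P)
      (∑ G ∈ hfin.toFinset, (-1) ^ n * (- -Polynomial.X) ^ ExtPerm.dim G) := by
    rw [ExtPerm.enumerator, finsum_mem_eq_finite_toFinset_sum _ hfin]
    exact ExtPerm.HasSpecialization.sum _ fun G hG =>
      hP.hasSpecialization_faceEnumerator _ (hfin.mem_toFinset.1 hG)
  refine ⟨h.mem_QSym, h.ps1_eval.1, ?_⟩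
  rw [h.ps1_eval.2, ← Finset.mul_sum, ← mul_assoc, ← mul_pow, neg_one_mul, neg_neg, one_pow,
    one_mul, ExtPerm.fPolynomial_eq_sum hfin]
  simp
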